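/- Let $S^2\subset\mathbb{R}^3$ be the unit sphere with its geodesic distance, and let $B_R(p_0)\subset S^2$ be the open geodesic ball of radius $R$ about $p_0$. An immersed network $\Gamma:G\to S^2$ consists of a connected graph $G$, obtained from finitely many (at least one) copies of $[0,1]$ by gluing end points according to an equivalence relation on them (the classes are the vertices of $G$, and the order of a vertex is the number of end points glued there), and a continuous map $\Gamma:G\to S^2$ that is a $C^1$ immersion on each edge $[0,1]$, end points included. Its length $L_{S^2}(\Gamma)$ is the sum of the lengths of its edges. There is a constant $R_0>0$, depending only on the sphere, such that the following holds for all $p_0\in S^2$ and all $0<R<R_0$. Let $A,B,C\in B_R(p_0)$ be distinct points, and let $\Gamma_*:G\to S^2$ be an immersed network contained in $B_R(p_0)$ such that 1. $G$ has exactly one vertex that is not of order one; it is mapped to a point $S\in B_R(p_0)$; and $G$ has exactly three edges, which start at this vertex and are mapped to great-circle arcs $SA$, $SB$, $SC$; 2. the unit tangent vectors $\tau_{SA},\tau_{SB},\tau_{SC}$ at $S$ of these arcs, directed from $S$ to $A$, $B$, $C$, satisfy $\tau_{SA}+\tau_{SB}+\tau_{SC}=0$, that is, they form angles of $120^\circ$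 with each other. Then every immersed network $\Gamma:H\to S^2$ contained in $B_R(p_0)$ with the same boundary vertex set $\{A,B,C\}$, meaning that $\{A,B,C\}$ is the image under $\Gamma$ of some set of vertices of $H$ (for instance of its vertices of order one), satisfies $$L_{S^2}(\Gamma_*)\le L_{S^2}(\Gamma).$$ -/

import Mathlib

open Set

noncomputable section

/-- Euclidean three-space. -/
abbrev E3 : Type := EuclideanSpace ℝ (Fin 3)

/-- The standard unit sphere in Euclidean three-space. -/
abbrev S2 : Type := Metric.sphere (0 : E3) 1

/-- The geodesic distance on the unit sphere: the angle `arccos ⟪x, y⟫` between unit vectors. -/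
def sphereDist (x y : S2) : ℝ := InnerProductGeometry.angle (x : E3) (y : E3)

/-- The open geodesic ball of radius `R` about `p₀`. -/
def geodesicBall (p₀ : S2) (R : ℝ) : Set S2 := {x | sphereDist p₀ x < R}

/-- The velocity in `E3` of a curve `[0,1] → S2` (one-sided at the two ends). Curves are written
as functions on `ℝ`, of which only the restriction to `[0,1]` is ever used. -/
def velocity (γ : ℝ → S2) (t : ℝ) : E3 := derivWithin (fun s => (γ s : E3)) (Icc 0 1) t

/-- `γ : [0,1] → S2` is a `C¹` immersion, up to and including the end points. -/
def IsC1Immersion (γ : ℝ → S2) : Prop :=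
  ContDiffOn ℝ 1 (fun s => (γ s : E3)) (Icc 0 1) ∧ ∀ t ∈ Icc (0 : ℝ) 1, velocity γ t ≠ 0

/-- The length of a `C¹` curve `[0,1] → S2` for the metric induced from `E3`. -/
def curveLength (γ : ℝ → S2) : ℝ := ∫ t in (0 : ℝ)..1, ‖velocity γ t‖

/-- `γ : [0,1] → S2` traverses a great-circle arc: up to a strictly increasing `C¹` change of
parameter `θ`, it is the unit speed geodesic `θ ↦ cos θ • p + sin θ • v`. -/
def IsGreatCircleArc (γ : ℝ → S2) : Prop :=
  ∃ (p v : E3) (θ : ℝ → ℝ), ‖p‖ = 1 ∧ ‖v‖ = 1 ∧ inner ℝ p v = 0 ∧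
    ContDiffOn ℝ 1 θ (Icc 0 1) ∧ StrictMonoOn θ (Icc 0 1) ∧
    ∀ t ∈ Icc (0 : ℝ) 1, (γ t : E3) = Real.cos (θ t) • p + Real.sin (θ t) • v

/-- The end point of `[0,1]` named by a Boolean: `false` is `0` and `true` is `1`. -/
def endParam (b : Bool) : ℝ := if b then 1 else 0

/-- An immersed network in the unit sphere. The graph `G` consists of `N ≥ 1` copies
`[0,1] × {i}` of the unit interval whose `2 N` end points are glued by the equivalence relation
`rel`; the pair `(i, false)` stands for the end point `(0, i)` and `(i, true)` for `(1, i)`.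
A continuous map `Γ : G → S2` that is a `C¹` immersion on each edge is the same as a family of
`C¹` immersions `curve i` that takes equal values at glued end points. The graph is
connected: any two of its vertices are joined by a chain of edges. -/
structure ImmersedNetwork where
  N : ℕ
  N_pos : 0 < N
  rel : Setoid (Fin N × Bool)
  curve : Fin N → ℝ → S2
  immersion : ∀ i, IsC1Immersion (curve i)
  glue : ∀ d e : Fin N × Bool, rel d e → curve d.1 (endParam d.2) = curve e.1 (endParam e.2)
  connected : ∀ u v : Quotient rel, Relation.ReflTransGen
    (fun x y => ∃ (i : Fin N) (b : Bool), x = Quotient.mk rel (i, b) ∧ y = Quotient.mk rel (i, !b))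
    u v

namespace ImmersedNetwork

variable (Γ : ImmersedNetwork)

/-- The vertices of the graph: the classes of glued end points of edges. -/
abbrev Vertex : Type := Quotient Γ.rel

/-- An edge end. It is also read as the edge directed away from this end. -/
abbrev Dart : Type := Fin Γ.N × Bool

variable {Γ} in
/-- The same edge, directed the other way. -/
def Dart.rev (d : Γ.Dart) : Γ.Dart := (d.1, !d.2)

/-- The vertex from which a directed edge issues. -/
def tail (d : Γ.Dart) : Γ.Vertex := Quotient.mk Γ.rel d

/-- The vertex at which a directed edge arrives. -/
def head (d : Γ.Dart) : Γ.Vertex := Γ.tail d.rev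

/-- The value of the map `Γ : G → S2` at a vertex. -/
def point (v : Γ.Vertex) : S2 :=
  Quotient.lift (fun d : Γ.Dart => Γ.curve d.1 (endParam d.2)) Γ.glue v

/-- The order of a vertex: the number of edge ends glued together there. -/
def order (v : Γ.Vertex) : ℕ := {d : Γ.Dart | Γ.tail d = v}.ncard

/-- The unit tangent vector, at its tail, of a directed edge, pointing into the edge. -/
def unitTangent (d : Γ.Dart) : E3 :=
  let w : E3 := if d.2 then -velocity (Γ.curve d.1) 1 else velocity (Γ.curve d.1) 0
  (‖w‖⁻¹ : ℝ) • w

/-- The total length of the network. -/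
def length : ℝ := ∑ i, curveLength (Γ.curve i)

/-- The image of the network is contained in `U`. -/
def ContainedIn (U : Set S2) : Prop := ∀ i, ∀ t ∈ Icc (0 : ℝ) 1, Γ.curve i t ∈ U

/-- `Γ` is a spherical Steiner network joining `A`, `B`, `C` at the single junction `S`. -/
def IsSteinerTripod (S A B C : S2) : Prop :=
  ∃ (s : Γ.Vertex) (dA dB dC : Γ.Dart),
    -- `s` is the only interior vertex, i.e. the only one that is not of order one; it lies at `S`
    (∀ v, Γ.order v ≠ 1 ↔ v = s) ∧ Γ.point s = S ∧
    -- there are exactly three edges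
    dA.1 ≠ dB.1 ∧ dA.1 ≠ dC.1 ∧ dB.1 ≠ dC.1 ∧ (∀ i, i = dA.1 ∨ i = dB.1 ∨ i = dC.1) ∧
    -- they go from `S` to `A`, `B`, `C`
    Γ.tail dA = s ∧ Γ.tail dB = s ∧ Γ.tail dC = s ∧
    Γ.point (Γ.head dA) = A ∧ Γ.point (Γ.head dB) = B ∧ Γ.point (Γ.head dC) = C ∧
    -- they are great-circle arcs
    (∀ i, IsGreatCircleArc (Γ.curve i)) ∧
    -- they meet at angles of 120 degrees
    Γ.unitTangent dA + Γ.unitTangent dB + Γ.unitTangent dC = 0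

end ImmersedNetwork

end

/-!
The length of a competitor is bounded below by a sum of three distances, and this sum is minimized
by a convexity argument; both steps work in any ball of radius less than `π / 8`.

Connectedness of the competitor `Γ` yields a vertex `p` that is joined to vertices over `A`, `B` and
`C` by edge-disjoint paths (`exists_branch_vertex`). As an edge is at least as long as the geodesic
distance of its end points (`sphereDist_le_curveLength`), the triangle inequality shows that the
length of `Γ` is at least `d(P, A) + d(P, B) + d(P, C)`, where `P` is the image of `p`.

The distance to a point `A` is a convex function on a small ball, with gradient `-τ_SA` at `S`, so
that `d(P, A) ≥ d(S, A) - ⟪τ_SA, w⟫`, where `w` is the inverse image of `P` under the exponential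
map at `S` (`exists_sub_inner_le_angle`). This form of convexity is the trigonometric inequality
`cos_mul_cos_add_le`, which comes from the concavity of sine and cosine. In the sum over `A`, `B`,
`C` the linear terms cancel, because the three unit tangent vectors at `S` add up to zero. What is
left is `d(S, A) + d(S, B) + d(S, C)`, which is the length of the tripod, since a great-circle arc
that stays in a small ball is a minimizing geodesic (`dart_eq_geodesic`).
-/

/-! ### The tangent line inequality for spherical distances -/

section Tangent

open Real InnerProductGeometry

variable {E : Type*} [NormedAddCommGroup E] [InnerProductSpace ℝ E]

theorem mul_sin_le_sin_mul {φ c : ℝ} (hφ : 0 ≤ φ) (hφ' : φ ≤ π) (hc : 0 ≤ c) (hc' : c ≤ 1) :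
    c * sin φ ≤ sin (c * φ) := by
  have h := strictConcaveOn_sin_Icc.concaveOn.2 (x := 0) (y := φ) ⟨le_rfl, pi_pos.le⟩ ⟨hφ, hφ'⟩
    (sub_nonneg.2 hc') hc (by ring)
  simpa using h

/-- The bound is the concavity of `x ↦ cos x - sin x = √2 cos (x + π / 4)` on `[0, π / 4]`. -/
theorem cos_sub_sin_mul_ge {φ k : ℝ} (hφ : 0 ≤ φ) (hφ' : φ ≤ π / 4) (hk : 0 ≤ k) (hk' : k ≤ 1) :
    (1 - k) + k * (cos φ - sin φ) ≤ cos (k * φ) - sin (k * φ) := by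
  have hπ := pi_pos
  have h := strictConcaveOn_cos_Icc.concaveOn.2 (x := π / 4) (y := φ + π / 4)
    ⟨by linarith, by linarith⟩ ⟨by linarith, by linarith⟩ (sub_nonneg.2 hk') hk (by ring)
  simp only [smul_eq_mul] at h
  rw [show (1 - k) * (π / 4) + k * (φ + π / 4) = k * φ + π / 4 by ring, cos_add, cos_add,
    cos_pi_div_four, sin_pi_div_four] at h
  have h2 : (0 : ℝ) < √2 / 2 := by positivity
  nlinarith [h, h2]

/-- In a spherical triangle with two sides `a`, `φ` and the cosine `c` of the angle between them,
the left side is the cosine of the third side (law of cosines); the inequality says that the third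
side is at least its first order expansion `a - c φ` in `φ`. -/
theorem cos_mul_cos_add_le {a φ c : ℝ} (ha : 0 ≤ a) (ha' : a ≤ π / 4) (hφ : 0 ≤ φ)
    (hφ' : φ ≤ π / 4) (hc : |c| ≤ 1) :
    cos a * cos φ + sin a * (sin φ * c) ≤ cos (a - c * φ) := by
  have hπ := pi_pos
  have hsa : 0 ≤ sin a := sin_nonneg_of_nonneg_of_le_pi ha (by linarith)
  have hsac : sin a ≤ cos a := by
    rw [← cos_pi_div_two_sub]
    exact cos_le_cos_of_nonneg_of_le_pi ha (by linarith) (by linarith)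
  have hX : cos φ ≤ cos (|c| * φ) :=
    cos_le_cos_of_nonneg_of_le_pi (by positivity) (by linarith) (mul_le_of_le_one_left hφ hc)
  rw [cos_sub]
  rcases le_or_gt 0 c with h0 | h0
  · rw [abs_of_nonneg h0] at hc hX
    have hY := mul_sin_le_sin_mul hφ (by linarith) h0 hc
    nlinarith [mul_nonneg (hsa.trans hsac) (sub_nonneg.2 hX), mul_nonneg hsa (sub_nonneg.2 hY)]
  · rw [abs_of_neg h0] at hc hX
    have hY := cos_sub_sin_mul_ge hφ hφ' (neg_nonneg.2 h0.le) hc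
    have hcos := mul_nonneg (sub_nonneg.2 hc) (sub_nonneg.2 (cos_le_one φ))
    rw [show c * φ = -(-c * φ) by ring, cos_neg, sin_neg]
    have hXY : sin (-c * φ) - (-c) * sin φ ≤ cos (-c * φ) - cos φ := by nlinarith
    nlinarith [mul_nonneg (sub_nonneg.2 hsac) (sub_nonneg.2 hX),
      mul_nonneg hsa (sub_nonneg.2 hXY)]

theorem norm_cos_smul_add_sin_smul {p v : E} (hp : ‖p‖ = 1) (hv : ‖v‖ = 1)
    (hpv : inner ℝ p v = 0) (x : ℝ) : ‖cos x • p + sin x • v‖ = 1 := by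
  rw [← sq_eq_sq₀ (norm_nonneg _) zero_le_one, norm_add_sq_real, norm_smul, norm_smul,
    inner_smul_left, inner_smul_right, hpv, hp, hv, mul_one, mul_one, norm_eq_abs, norm_eq_abs,
    sq_abs, sq_abs]
  simp

theorem angle_cos_smul_add_sin_smul {p v : E} (hp : ‖p‖ = 1) (hv : ‖v‖ = 1)
    (hpv : inner ℝ p v = 0) {x : ℝ} (hx : 0 ≤ x) (hx' : x ≤ π) :
    angle p (cos x • p + sin x • v) = x := by
  rw [InnerProductGeometry.angle, hp, norm_cos_smul_add_sin_smul hp hv hpv, inner_add_right,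
    inner_smul_right, inner_smul_right, hpv, real_inner_self_eq_norm_sq, hp, one_pow, mul_one,
    mul_zero, add_zero, mul_one, div_one, arccos_cos hx hx']

/-- Polar coordinates about the unit vector `S`. The direction `v` has norm one unless `P = ± S`,
where it is zero. -/
theorem exists_polar_direction {S P : E} (hS : ‖S‖ = 1) (hP : ‖P‖ = 1) :
    ∃ v : E, ‖v‖ ≤ 1 ∧ P = cos (angle S P) • S + sin (angle S P) • v := by
  have hcos : inner ℝ S P = cos (angle S P) := inner_eq_cos_angle_of_norm_eq_one hS hP
  have hsin : 0 ≤ sin (angle S P) := sin_angle_nonneg S P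
  have hnorm : ‖P - cos (angle S P) • S‖ = sin (angle S P) := by
    rw [← sq_eq_sq₀ (norm_nonneg _) hsin, norm_sub_sq_real, norm_smul, inner_smul_right,
      real_inner_comm, hcos, hS, hP, norm_eq_abs, mul_one, sq_abs, sin_sq]
    ring
  rcases hsin.eq_or_lt with h0 | hpos
  · refine ⟨0, by simp, ?_⟩
    rw [← h0, norm_eq_zero, sub_eq_zero] at hnorm
    simpa using hnorm
  · refine ⟨(sin (angle S P))⁻¹ • (P - cos (angle S P) • S), ?_, ?_⟩
    · rw [norm_smul, hnorm, norm_inv, norm_eq_abs, abs_of_pos hpos, inv_mul_cancel₀ hpos.ne']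
    · rw [smul_inv_smul₀ hpos.ne']
      abel

/-- The vector `w` is the inverse image of `P` under the exponential map at `S`, and the inequality
is the tangent line inequality for the convex function `P ↦ angle P Q` at `S`, where
`Q = cos a • S + sin a • τ` and the gradient is `-τ`. -/
theorem exists_sub_inner_le_angle {S P : E} (hS : ‖S‖ = 1) (hP : ‖P‖ = 1)
    (hSP : angle S P ≤ π / 4) :
    ∃ w : E, ∀ τ : E, ‖τ‖ = 1 → inner ℝ S τ = 0 → ∀ a : ℝ, 0 ≤ a → a ≤ π / 4 →
      a - inner ℝ τ w ≤ angle P (cos a • S + sin a • τ) := by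
  obtain ⟨v, hv, hPv⟩ := exists_polar_direction hS hP
  have hφ := angle_nonneg S P
  have hSPcos : inner ℝ S P = cos (angle S P) := inner_eq_cos_angle_of_norm_eq_one hS hP
  set φ := angle S P with hφdef
  refine ⟨φ • v, fun τ hτ hSτ a ha ha' => ?_⟩
  have hπ := pi_pos
  have hc : |inner ℝ τ v| ≤ 1 := by
    refine (abs_real_inner_le_norm τ v).trans ?_
    rw [hτ, one_mul]
    exact hv
  have hQ := norm_cos_smul_add_sin_smul hS hτ hSτ a
  have hPτ : inner ℝ P τ = sin φ * inner ℝ τ v := by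
    nth_rewrite 1 [hPv]
    rw [inner_add_left, inner_smul_left, inner_smul_left, hSτ, real_inner_comm]
    simp
  have hinner : cos (angle P (cos a • S + sin a • τ)) =
      cos a * cos φ + sin a * (sin φ * inner ℝ τ v) := by
    rw [← inner_eq_cos_angle_of_norm_eq_one hP hQ, inner_add_right, inner_smul_right,
      inner_smul_right, hPτ, real_inner_comm, hSPcos]
  have hle := cos_mul_cos_add_le ha ha' hφ hSP hc
  rw [← hinner] at hle
  rw [inner_smul_right, mul_comm φ]
  by_contra! hlt
  refine hle.not_gt (cos_lt_cos_of_nonneg_of_le_pi (angle_nonneg _ _) ?_ hlt)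
  nlinarith [abs_le.1 hc]

/-- A point at which three unit vectors pointing along geodesics sum to zero minimizes the sum of
the distances to the end points of these geodesics. -/
theorem add_add_le_angle_of_tangents_sum_zero {S P τ₁ τ₂ τ₃ : E} (hS : ‖S‖ = 1) (hP : ‖P‖ = 1)
    (hSP : angle S P ≤ π / 4) (h₁ : ‖τ₁‖ = 1) (h₂ : ‖τ₂‖ = 1) (h₃ : ‖τ₃‖ = 1)
    (hS₁ : inner ℝ S τ₁ = 0) (hS₂ : inner ℝ S τ₂ = 0) (hS₃ : inner ℝ S τ₃ = 0)
    (hsum : τ₁ + τ₂ + τ₃ = 0) {a₁ a₂ a₃ : ℝ} (ha₁ : 0 ≤ a₁) (ha₁' : a₁ ≤ π / 4)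
    (ha₂ : 0 ≤ a₂) (ha₂' : a₂ ≤ π / 4) (ha₃ : 0 ≤ a₃) (ha₃' : a₃ ≤ π / 4) :
    a₁ + a₂ + a₃ ≤ angle P (cos a₁ • S + sin a₁ • τ₁) + angle P (cos a₂ • S + sin a₂ • τ₂) +
      angle P (cos a₃ • S + sin a₃ • τ₃) := by
  obtain ⟨w, hw⟩ := exists_sub_inner_le_angle hS hP hSP
  have h := congrArg (fun x => inner ℝ x w) hsum
  simp only [inner_add_left, inner_zero_left] at h
  linarith [hw τ₁ h₁ hS₁ a₁ ha₁ ha₁', hw τ₂ h₂ hS₂ a₂ ha₂ ha₂', hw τ₃ h₃ hS₃ a₃ ha₃ ha₃']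

end Tangent

/-! ### Lengths of curves in the sphere -/

section Curves

open Real InnerProductGeometry

theorem norm_coe_sphere (x : S2) : ‖(x : E3)‖ = 1 := by
  simp

variable {γ : ℝ → S2}

theorem IsC1Immersion.hasDerivWithinAt (hγ : IsC1Immersion γ) {t : ℝ} (ht : t ∈ Icc (0 : ℝ) 1) :
    HasDerivWithinAt (fun s => (γ s : E3)) (velocity γ t) (Icc 0 1) t :=
  (hγ.1.differentiableOn one_ne_zero t ht).hasDerivWithinAt

theorem IsC1Immersion.continuousOn_velocity (hγ : IsC1Immersion γ) :
    ContinuousOn (velocity γ) (Icc 0 1) :=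
  hγ.1.continuousOn_derivWithin uniqueDiffOn_Icc_zero_one le_rfl

theorem inner_velocity_eq_zero (hγ : IsC1Immersion γ) {t : ℝ} (ht : t ∈ Icc (0 : ℝ) 1) :
    inner ℝ (γ t : E3) (velocity γ t) = 0 := by
  have h := (hγ.hasDerivWithinAt ht).inner ℝ (hγ.hasDerivWithinAt ht)
  have h1 : (fun s => inner ℝ (γ s : E3) (γ s : E3)) = fun _ => (1 : ℝ) := by
    funext s
    rw [real_inner_self_eq_norm_sq, norm_coe_sphere, one_pow]
  rw [h1] at h
  have h2 := (uniqueDiffOn_Icc_zero_one t ht).eq_deriv _ h (hasDerivWithinAt_const t _ (1 : ℝ))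
  rw [real_inner_comm (γ t : E3) (velocity γ t)] at h2
  linarith

theorem curveLength_nonneg (γ : ℝ → S2) : 0 ≤ curveLength γ :=
  intervalIntegral.integral_nonneg zero_le_one fun _ _ => norm_nonneg _

/-- The function `x ↦ arcsin ⟪u, x⟫` is one-Lipschitz on the sphere. -/
theorem arcsin_inner_sub_le_curveLength (hγ : IsC1Immersion γ) {u : E3} (hu : ‖u‖ = 1)
    (hlt : ∀ t ∈ Icc (0 : ℝ) 1, |inner ℝ u (γ t : E3)| < 1) :
    arcsin (inner ℝ u (γ 1 : E3)) - arcsin (inner ℝ u (γ 0 : E3)) ≤ curveLength γ := by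
  have hcont : ContinuousOn (fun s => (γ s : E3)) (Icc 0 1) := hγ.1.continuousOn
  refine intervalIntegral.sub_le_integral_of_hasDeriv_right_of_le zero_le_one
    (g := fun t => arcsin (inner ℝ u (γ t : E3)))
    (g' := fun t => 1 / √(1 - inner ℝ u (γ t : E3) ^ 2) * inner ℝ u (velocity γ t))
    (φ := fun t => ‖velocity γ t‖) ?_ ?_ ?_ ?_
  · exact continuous_arcsin.comp_continuousOn (continuousOn_const.inner hcont)
  · intro t ht
    have hd : HasDerivAt (fun s => (γ s : E3)) (velocity γ t) t :=
      (hγ.hasDerivWithinAt (Ioo_subset_Icc_self ht)).hasDerivAt (Icc_mem_nhds ht.1 ht.2)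
    have hi : HasDerivAt (fun s => inner ℝ u (γ s : E3)) (inner ℝ u (velocity γ t)) t := by
      simpa using (hasDerivAt_const t u).inner ℝ hd
    obtain ⟨h1, h2⟩ := abs_lt.1 (hlt t (Ioo_subset_Icc_self ht))
    exact ((hasDerivAt_arcsin h1.ne' h2.ne).comp t hi).hasDerivWithinAt
  · exact hγ.continuousOn_velocity.norm.integrableOn_Icc
  · intro t ht
    have ht' := Ioo_subset_Icc_self ht
    have hpos : 0 < 1 - inner ℝ u (γ t : E3) ^ 2 := by
      have := (sq_lt_one_iff_abs_lt_one _).2 (hlt t ht')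
      linarith
    -- the component of `u` tangent to the sphere at `γ t` has norm `√(1 - ⟪u, γ t⟫ ^ 2)`
    have hnorm : ‖u - inner ℝ u (γ t : E3) • (γ t : E3)‖ = √(1 - inner ℝ u (γ t : E3) ^ 2) := by
      rw [eq_comm, sqrt_eq_iff_eq_sq hpos.le (norm_nonneg _), norm_sub_sq_real, norm_smul,
        inner_smul_right, norm_coe_sphere, hu, mul_one, norm_eq_abs, sq_abs]
      ring
    have hinner : inner ℝ u (velocity γ t) ≤
        √(1 - inner ℝ u (γ t : E3) ^ 2) * ‖velocity γ t‖ := by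
      have h := real_inner_le_norm (u - inner ℝ u (γ t : E3) • (γ t : E3)) (velocity γ t)
      rwa [inner_sub_left, inner_smul_left, inner_velocity_eq_zero hγ ht', mul_zero, sub_zero,
        hnorm] at h
    rw [one_div, inv_mul_le_iff₀ (sqrt_pos.2 hpos)]
    exact hinner

/-- A curve of diameter less than `π / 2` is at least as long as the distance of its end points. The
comparison function is `x ↦ arcsin ⟪u, x⟫`, the signed distance from the great circle that bisects
the two end points. -/
theorem sphereDist_le_curveLength (hγ : IsC1Immersion γ)
    (hpos : ∀ s ∈ Icc (0 : ℝ) 1, ∀ t ∈ Icc (0 : ℝ) 1, 0 < inner ℝ (γ s : E3) (γ t : E3)) :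
    sphereDist (γ 0) (γ 1) ≤ curveLength γ := by
  have h0 : (0 : ℝ) ∈ Icc (0 : ℝ) 1 := ⟨le_rfl, zero_le_one⟩
  have h1 : (1 : ℝ) ∈ Icc (0 : ℝ) 1 := ⟨zero_le_one, le_rfl⟩
  have ha := norm_coe_sphere (γ 0)
  have hb := norm_coe_sphere (γ 1)
  have hcos : inner ℝ (γ 0 : E3) (γ 1 : E3) = cos (sphereDist (γ 0) (γ 1)) :=
    inner_eq_cos_angle_of_norm_eq_one ha hb
  have hnn : 0 ≤ sphereDist (γ 0) (γ 1) := angle_nonneg _ _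
  have hle : sphereDist (γ 0) (γ 1) ≤ π := angle_le_pi _ _
  set δ := sphereDist (γ 0) (γ 1) with hδ
  rcases hnn.eq_or_lt with hz | hδpos
  · rw [← hz]
    exact curveLength_nonneg γ
  have hs : 0 < sin (δ / 2) := sin_pos_of_pos_of_lt_pi (by linarith) (by linarith)
  have hc2 : cos δ = 1 - 2 * sin (δ / 2) ^ 2 := by
    have h := cos_two_mul (δ / 2)
    rw [mul_div_cancel₀ δ two_ne_zero] at h
    linarith [sin_sq_add_cos_sq (δ / 2)]
  set a : E3 := (γ 0 : E3)
  set b : E3 := (γ 1 : E3)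
  set u : E3 := (2 * sin (δ / 2))⁻¹ • (b - a) with hu
  have hnorm : ‖b - a‖ = 2 * sin (δ / 2) := by
    rw [← sq_eq_sq₀ (norm_nonneg _) (by positivity), norm_sub_sq_real, real_inner_comm, hcos, ha,
      hb, hc2]
    ring
  have hu1 : ‖u‖ = 1 := by
    rw [hu, norm_smul, hnorm, norm_inv, norm_eq_abs, abs_of_pos (by positivity)]
    field_simp
  have hub : inner ℝ u b = sin (δ / 2) := by
    rw [hu, inner_smul_left, inner_sub_left, hcos, real_inner_self_eq_norm_sq, hb, hc2]
    simp only [map_inv₀, conj_trivial]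
    field_simp
    ring
  have hua : inner ℝ u a = -sin (δ / 2) := by
    rw [hu, inner_smul_left, inner_sub_left, real_inner_comm, hcos, real_inner_self_eq_norm_sq, ha,
      hc2]
    simp only [map_inv₀, conj_trivial]
    field_simp
    ring
  have hlt : ∀ t ∈ Icc (0 : ℝ) 1, |inner ℝ u (γ t : E3)| < 1 := by
    intro t ht
    have ht1 := norm_coe_sphere (γ t)
    refine lt_of_le_of_ne ?_ ?_
    · simpa [hu1, ht1] using abs_real_inner_le_norm u (γ t : E3)
    · intro h
      rcases (abs_eq zero_le_one).1 h with h | h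
      · have h' : u = (γ t : E3) := (inner_eq_one_iff_of_norm_eq_one hu1 ht1).1 h
        have := hpos t ht 0 h0
        rw [← h'] at this
        change 0 < inner ℝ u a at this
        linarith
      · have h' : u = -(γ t : E3) := by
          refine (inner_eq_one_iff_of_norm_eq_one (𝕜 := ℝ) hu1 (by rwa [norm_neg])).1 ?_
          rw [inner_neg_right, h, neg_neg]
        have := hpos t ht 1 h1
        rw [← neg_neg (γ t : E3), ← h', inner_neg_left] at this
        change 0 < -inner ℝ u b at this
        linarith
  have h := arcsin_inner_sub_le_curveLength hγ hu1 hlt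
  change arcsin (inner ℝ u b) - arcsin (inner ℝ u a) ≤ _ at h
  rw [hub, hua, arcsin_neg, arcsin_sin (by linarith) (by linarith)] at h
  linarith

end Curves

/-! ### Great-circle arcs -/

section Arcs

open Real InnerProductGeometry

variable {γ : ℝ → S2}

/-- A great-circle arc without antipodal points is shorter than `π`, and it is the unit speed
geodesic of that length with either of its two initial directions. -/
theorem exists_arc_length (hγ : IsC1Immersion γ) (harc : IsGreatCircleArc γ)
    (hanti : ∀ t ∈ Icc (0 : ℝ) 1, (γ t : E3) ≠ -(γ 0 : E3)) :
    ∃ ℓ, 0 < ℓ ∧ ℓ < π ∧ curveLength γ = ℓ ∧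
      ‖‖velocity γ 0‖⁻¹ • velocity γ 0‖ = 1 ∧ ‖‖velocity γ 1‖⁻¹ • -velocity γ 1‖ = 1 ∧
      (γ 1 : E3) = cos ℓ • (γ 0 : E3) + sin ℓ • (‖velocity γ 0‖⁻¹ • velocity γ 0) ∧
      (γ 0 : E3) = cos ℓ • (γ 1 : E3) + sin ℓ • (‖velocity γ 1‖⁻¹ • -velocity γ 1) := by
  have h0 : (0 : ℝ) ∈ Icc (0 : ℝ) 1 := ⟨le_rfl, zero_le_one⟩
  have h1 : (1 : ℝ) ∈ Icc (0 : ℝ) 1 := ⟨zero_le_one, le_rfl⟩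
  obtain ⟨p, v, θ, hp, hv, hpv, hθ, hmono, hγθ⟩ := harc
  set n : ℝ → E3 := fun x => cos (x + π / 2) • p + sin (x + π / 2) • v with hn
  have hn1 : ∀ x, ‖n x‖ = 1 := fun x => norm_cos_smul_add_sin_smul hp hv hpv _
  have hvel : ∀ t ∈ Icc (0 : ℝ) 1, velocity γ t = derivWithin θ (Icc 0 1) t • n (θ t) := by
    intro t ht
    have hd : HasDerivWithinAt θ (derivWithin θ (Icc 0 1) t) (Icc 0 1) t :=
      (hθ.differentiableOn one_ne_zero t ht).hasDerivWithinAt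
    have h := (hd.cos.smul_const p).add (hd.sin.smul_const v)
    have h' : HasDerivWithinAt (fun s => (γ s : E3)) _ (Icc 0 1) t :=
      h.congr (fun s hs => hγθ s hs) (hγθ t ht)
    rw [(uniqueDiffOn_Icc_zero_one t ht).eq_deriv _ (hγ.hasDerivWithinAt ht) h', hn]
    simp only [cos_add_pi_div_two, sin_add_pi_div_two]
    module
  have hnonneg : ∀ t, 0 ≤ derivWithin θ (Icc 0 1) t := fun t => hmono.monotoneOn.derivWithin_nonneg
  have hnorm : ∀ t ∈ Icc (0 : ℝ) 1, ‖velocity γ t‖ = derivWithin θ (Icc 0 1) t := by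
    intro t ht
    rw [hvel t ht, norm_smul, hn1, mul_one, norm_of_nonneg (hnonneg t)]
  have hunit : ∀ t ∈ Icc (0 : ℝ) 1, ‖velocity γ t‖⁻¹ • velocity γ t = n (θ t) := by
    intro t ht
    have hne : derivWithin θ (Icc 0 1) t ≠ 0 := by
      rw [← hnorm t ht]
      exact norm_ne_zero_iff.2 (hγ.2 t ht)
    rw [hnorm t ht, hvel t ht, inv_smul_smul₀ hne]
  have hlen : curveLength γ = θ 1 - θ 0 := by
    have hcongr : curveLength γ = ∫ t in (0 : ℝ)..1, derivWithin θ (Icc 0 1) t := by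
      refine intervalIntegral.integral_congr fun t ht => hnorm t ?_
      rwa [uIcc_of_le zero_le_one] at ht
    rw [hcongr]
    refine intervalIntegral.integral_eq_sub_of_hasDerivAt_of_le zero_le_one hθ.continuousOn ?_ ?_
    · intro t ht
      exact (hθ.differentiableOn one_ne_zero t (Ioo_subset_Icc_self ht)).hasDerivWithinAt.hasDerivAt
        (Icc_mem_nhds ht.1 ht.2)
    · refine ContinuousOn.intervalIntegrable ?_
      rw [uIcc_of_le zero_le_one]
      exact hθ.continuousOn_derivWithin uniqueDiffOn_Icc_zero_one le_rfl
  have hlt : θ 1 - θ 0 < π := by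
    by_contra! hge
    -- otherwise the arc passes through the antipode of its starting point
    obtain ⟨t, ht, hθt⟩ := intermediate_value_Icc zero_le_one hθ.continuousOn
      (show θ 0 + π ∈ Icc (θ 0) (θ 1) from ⟨by linarith [pi_pos], by linarith⟩)
    refine hanti t ht ?_
    rw [hγθ t ht, hγθ 0 h0, hθt, cos_add_pi, sin_add_pi]
    module
  refine ⟨θ 1 - θ 0, sub_pos.2 (hmono h0 h1 zero_lt_one), hlt, hlen, ?_, ?_, ?_, ?_⟩
  · rw [hunit 0 h0, hn1]
  · rw [smul_neg, norm_neg, hunit 1 h1, hn1]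
  · rw [hunit 0 h0, hγθ 0 h0, hγθ 1 h1, hn]
    simp only [cos_add_pi_div_two, sin_add_pi_div_two, cos_sub, sin_sub]
    have := sin_sq_add_cos_sq (θ 0)
    match_scalars
    · linear_combination (-cos (θ 1)) * this
    · linear_combination (-sin (θ 1)) * this
  · rw [smul_neg, hunit 1 h1, hγθ 0 h0, hγθ 1 h1, hn]
    simp only [cos_add_pi_div_two, sin_add_pi_div_two, cos_sub, sin_sub]
    have := sin_sq_add_cos_sq (θ 1)
    match_scalars
    · linear_combination (-cos (θ 0)) * this
    · linear_combination (-sin (θ 0)) * this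

end Arcs

/-! ### Branching in a connected graph -/

section Graph

variable {V E : Type*}

/-- The vertices from which `W` is reached in at most `n` steps of the edge relation, where
`adj e x y` says that the edge `e` joins `x` to `y`. -/
def stepsTo (adj : E → V → V → Prop) (W : Set V) : ℕ → Set V
  | 0 => W
  | n + 1 => stepsTo adj W n ∪ {x | ∃ e, ∃ y ∈ stepsTo adj W n, adj e x y}

theorem subset_stepsTo (adj : E → V → V → Prop) (W : Set V) (n : ℕ) : W ⊆ stepsTo adj W n := by
  induction n with
  | zero => exact subset_rfl
  | succ n ih => exact ih.trans subset_union_left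

theorem exists_mem_stepsTo {adj : E → V → V → Prop} {W : Set V} {c b : V} (hb : b ∈ W)
    (h : Relation.ReflTransGen (fun x y => ∃ e, adj e x y) c b) : ∃ n, c ∈ stepsTo adj W n := by
  induction h using Relation.ReflTransGen.head_induction_on with
  | refl => exact ⟨0, hb⟩
  | head hxy _ ih =>
    obtain ⟨e, he⟩ := hxy
    obtain ⟨n, hn⟩ := ih
    exact ⟨n + 1, Or.inr ⟨e, _, hn, he⟩⟩

variable [DecidableEq E]

/-- A shortest path from `c` to the set `W`, ending at `w`: its edges are `Q` and its vertices are
`U`. Every edge of `Q` starts outside `W`, and `Q` is long enough to connect `c` to `w` by way of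
any vertex of `U`. The induction on the number of steps also records that the path stays among the
vertices that need no more steps than `c`, whence a newly added edge is not yet in `Q`. -/
theorem exists_shortest_path {adj : E → V → V → Prop} {d : V → V → ℝ} {len : E → ℝ}
    (hself : ∀ x, d x x = 0) (htri : ∀ x y z, d x z ≤ d x y + d y z)
    (hends : ∀ e x y x' y', adj e x y → adj e x' y' → x' = x ∨ x' = y)
    (hlen : ∀ e x y, adj e x y → d x y ≤ len e) (W : Set V) (n : ℕ) :
    ∀ c ∈ stepsTo adj W n, ∃ w ∈ W, ∃ (Q : Finset E) (U : Set V), c ∈ U ∧ w ∈ U ∧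
      (∀ x ∈ U, d c x + d x w ≤ ∑ e ∈ Q, len e) ∧
      ∀ e ∈ Q, ∃ x y, adj e x y ∧ x ∉ W ∧ x ∈ U ∧ y ∈ U ∧
        x ∈ stepsTo adj W n ∧ y ∈ stepsTo adj W n := by
  induction n with
  | zero =>
    intro c hc
    exact ⟨c, hc, ∅, {c}, rfl, rfl, by rintro x rfl; simp [hself], by simp⟩
  | succ n ih =>
    intro c hc
    by_cases hcn : c ∈ stepsTo adj W n
    · obtain ⟨w, hw, Q, U, hcU, hwU, hd, hQ⟩ := ih c hcn
      refine ⟨w, hw, Q, U, hcU, hwU, hd, fun e he => ?_⟩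
      obtain ⟨x, y, hxy, hxW, hxU, hyU, hx, hy⟩ := hQ e he
      exact ⟨x, y, hxy, hxW, hxU, hyU, Or.inl hx, Or.inl hy⟩
    · obtain ⟨e, v, hv, hcv⟩ := hc.resolve_left hcn
      obtain ⟨w, hw, Q, U, hvU, hwU, hd, hQ⟩ := ih v hv
      have heQ : e ∉ Q := by
        intro he
        obtain ⟨x, y, hxy, -, -, -, hx, hy⟩ := hQ e he
        rcases hends e x y c v hxy hcv with rfl | rfl
        · exact hcn hx
        · exact hcn hy
      have hle := hlen e c v hcv
      refine ⟨w, hw, insert e Q, insert c U, mem_insert _ _, mem_insert_of_mem _ hwU, ?_, ?_⟩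
      · rw [Finset.sum_insert heQ]
        rintro x (rfl | hx)
        · linarith [hself x, htri x v w, hd v hvU, hself v]
        · linarith [htri c v x, hd x hx]
      · intro f hf
        rcases Finset.mem_insert.1 hf with rfl | hf
        · exact ⟨c, v, hcv, fun h => hcn (subset_stepsTo adj W n h), mem_insert _ _,
            mem_insert_of_mem _ hvU, hc, Or.inl hv⟩
        · obtain ⟨x, y, hxy, hxW, hxU, hyU, hx, hy⟩ := hQ f hf
          exact ⟨x, y, hxy, hxW, mem_insert_of_mem _ hxU, mem_insert_of_mem _ hyU,
            Or.inl hx, Or.inl hy⟩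

/-- Three vertices of a connected graph are joined to a common vertex by edge-disjoint paths: take
a shortest path from `a` to `b`, then a shortest path from `c` to that path. -/
theorem exists_branch_vertex [Fintype E] {adj : E → V → V → Prop} {d : V → V → ℝ} {len : E → ℝ}
    (hself : ∀ x, d x x = 0) (hcomm : ∀ x y, d x y = d y x)
    (htri : ∀ x y z, d x z ≤ d x y + d y z)
    (hends : ∀ e x y x' y', adj e x y → adj e x' y' → x' = x ∨ x' = y)
    (hlen : ∀ e x y, adj e x y → d x y ≤ len e) (hlen₀ : ∀ e, 0 ≤ len e)
    (hconn : ∀ u v, Relation.ReflTransGen (fun x y => ∃ e, adj e x y) u v) (a b c : V) :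
    ∃ p, d p a + d p b + d p c ≤ ∑ e, len e := by
  obtain ⟨n, hn⟩ := exists_mem_stepsTo (W := {b}) rfl (hconn a b)
  obtain ⟨w, rfl, Q, U, haU, hwU, hd, hQ⟩ :=
    exists_shortest_path hself htri hends hlen _ n a hn
  obtain ⟨m, hm⟩ := exists_mem_stepsTo hwU (hconn c w)
  obtain ⟨p, hpU, Q', U', hcU', hpU', hd', hQ'⟩ :=
    exists_shortest_path hself htri hends hlen U m c hm
  have hdisj : Disjoint Q Q' := by
    rw [Finset.disjoint_left]
    intro e he he'
    obtain ⟨x, y, hxy, -, hxU, hyU, -⟩ := hQ e he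
    obtain ⟨x', y', hxy', hxU', -⟩ := hQ' e he'
    rcases hends e x y x' y' hxy hxy' with rfl | rfl
    · exact hxU' hxU
    · exact hxU' hyU
  have hsum : ∑ e ∈ Q, len e + ∑ e ∈ Q', len e ≤ ∑ e, len e := by
    rw [← Finset.sum_union hdisj]
    exact Finset.sum_le_sum_of_subset_of_nonneg (Finset.subset_univ _) fun e _ _ => hlen₀ e
  exact ⟨p, by linarith [hd p hpU, hd' p hpU', hself p, hcomm p a, hcomm p c]⟩

end Graph

/-! ### Networks in a small ball -/

section Ball

open Real InnerProductGeometry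

theorem sphereDist_comm (x y : S2) : sphereDist x y = sphereDist y x :=
  angle_comm _ _

theorem sphereDist_self (x : S2) : sphereDist x x = 0 :=
  angle_self (norm_ne_zero_iff.1 (by rw [norm_coe_sphere]; exact one_ne_zero))

theorem sphereDist_triangle (x y z : S2) : sphereDist x z ≤ sphereDist x y + sphereDist y z :=
  angle_le_angle_add_angle _ _ _

theorem sphereDist_lt_of_mem_geodesicBall {p₀ x y : S2} {R : ℝ} (hx : x ∈ geodesicBall p₀ R)
    (hy : y ∈ geodesicBall p₀ R) : sphereDist x y < 2 * R := by
  have h := sphereDist_triangle x p₀ y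
  rw [sphereDist_comm x p₀] at h
  have hx' : sphereDist p₀ x < R := hx
  have hy' : sphereDist p₀ y < R := hy
  linarith

theorem inner_pos_of_mem_geodesicBall {p₀ x y : S2} {R : ℝ} (hR : R < π / 8)
    (hx : x ∈ geodesicBall p₀ R) (hy : y ∈ geodesicBall p₀ R) : 0 < inner ℝ (x : E3) (y : E3) := by
  have h := sphereDist_lt_of_mem_geodesicBall hx hy
  have h0 : 0 ≤ sphereDist x y := angle_nonneg _ _
  rw [inner_eq_cos_angle_of_norm_eq_one (norm_coe_sphere x) (norm_coe_sphere y)]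
  exact cos_pos_of_mem_Ioo ⟨by unfold sphereDist at h0; linarith [pi_pos],
    by unfold sphereDist at h; linarith [pi_pos]⟩

end Ball

namespace ImmersedNetwork

open Real InnerProductGeometry

variable (Γ : ImmersedNetwork) {p₀ : S2} {R : ℝ}

/-- A network in a small ball is at least as long as the tripod of geodesics that joins three of its
vertices to a suitable fourth one. -/
theorem exists_vertex_sphereDist_add_le_length (hR : R < π / 8)
    (hΓ : Γ.ContainedIn (geodesicBall p₀ R)) (a b c : Γ.Vertex) :
    ∃ p : Γ.Vertex, sphereDist (Γ.point p) (Γ.point a) + sphereDist (Γ.point p) (Γ.point b) +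
      sphereDist (Γ.point p) (Γ.point c) ≤ Γ.length := by
  refine exists_branch_vertex
    (adj := fun (i : Fin Γ.N) x y =>
      ∃ e : Bool, x = Quotient.mk Γ.rel (i, e) ∧ y = Quotient.mk Γ.rel (i, !e))
    (d := fun x y => sphereDist (Γ.point x) (Γ.point y)) (fun _ => sphereDist_self _)
    (fun _ _ => sphereDist_comm _ _) (fun _ _ _ => sphereDist_triangle _ _ _) ?_ ?_
    (fun i => curveLength_nonneg (Γ.curve i)) Γ.connected a b c
  · rintro i _ _ _ _ ⟨e, rfl, rfl⟩ ⟨f, rfl, rfl⟩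
    cases e <;> cases f <;> simp
  · rintro i _ _ ⟨e, rfl, rfl⟩
    have h := sphereDist_le_curveLength (Γ.immersion i) fun s hs t ht =>
      inner_pos_of_mem_geodesicBall hR (hΓ i s hs) (hΓ i t ht)
    cases e
    · simpa [point, endParam] using h
    · rw [sphereDist_comm]
      simpa [point, endParam] using h

variable {Γ}

theorem point_mem_of_containedIn {U : Set S2} (hΓ : Γ.ContainedIn U) (v : Γ.Vertex) :
    Γ.point v ∈ U := by
  induction v using Quotient.inductionOn with
  | h d =>
    refine hΓ d.1 (endParam d.2) ?_
    unfold endParam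
    split_ifs <;> simp

/-- An edge of a network in a small ball that is a great-circle arc is the minimizing geodesic in
the direction of its unit tangent vector. -/
theorem dart_eq_geodesic (hR : R < π / 8) (hΓ : Γ.ContainedIn (geodesicBall p₀ R)) (d : Γ.Dart)
    (harc : IsGreatCircleArc (Γ.curve d.1)) :
    0 ≤ curveLength (Γ.curve d.1) ∧ curveLength (Γ.curve d.1) ≤ π / 4 ∧ ‖Γ.unitTangent d‖ = 1 ∧
      inner ℝ (Γ.point (Γ.tail d) : E3) (Γ.unitTangent d) = 0 ∧
      (Γ.point (Γ.head d) : E3) = cos (curveLength (Γ.curve d.1)) • (Γ.point (Γ.tail d) : E3) +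
        sin (curveLength (Γ.curve d.1)) • Γ.unitTangent d := by
  obtain ⟨i, e⟩ := d
  have h0 : (0 : ℝ) ∈ Icc (0 : ℝ) 1 := ⟨le_rfl, zero_le_one⟩
  have h1 : (1 : ℝ) ∈ Icc (0 : ℝ) 1 := ⟨zero_le_one, le_rfl⟩
  have hi := Γ.immersion i
  obtain ⟨ℓ, hℓ, hℓπ, hlen, hu0, hu1, hγ1, hγ0⟩ := exists_arc_length hi harc fun t ht h => by
    have hpos := inner_pos_of_mem_geodesicBall hR (hΓ i t ht) (hΓ i 0 h0)
    rw [h, inner_neg_left, real_inner_self_eq_norm_sq, norm_coe_sphere] at hpos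
    norm_num at hpos
  have ho0 : inner ℝ (Γ.curve i 0 : E3) (‖velocity (Γ.curve i) 0‖⁻¹ • velocity (Γ.curve i) 0) =
      0 := by
    rw [inner_smul_right, inner_velocity_eq_zero hi h0, mul_zero]
  have ho1 : inner ℝ (Γ.curve i 1 : E3) (‖velocity (Γ.curve i) 1‖⁻¹ • -velocity (Γ.curve i) 1) =
      0 := by
    rw [inner_smul_right, inner_neg_right, inner_velocity_eq_zero hi h1, neg_zero, mul_zero]
  have hle : ℓ ≤ π / 4 := by
    have h := sphereDist_lt_of_mem_geodesicBall (hΓ i 0 h0) (hΓ i 1 h1)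
    rw [sphereDist, hγ1, angle_cos_smul_add_sin_smul (norm_coe_sphere _) hu0 ho0 hℓ.le hℓπ.le] at h
    linarith
  subst hlen
  cases e
  · exact ⟨hℓ.le, hle, by simpa [unitTangent] using hu0,
      by simpa [unitTangent, point, tail, endParam] using ho0,
      by simpa [unitTangent, point, tail, head, Dart.rev, endParam] using hγ1⟩
  · exact ⟨hℓ.le, hle, by simpa [unitTangent] using hu1,
      by simpa [unitTangent, point, tail, endParam] using ho1,
      by simpa [unitTangent, point, tail, head, Dart.rev, endParam] using hγ0⟩

end ImmersedNetwork

open Real InnerProductGeometry ImmersedNetwork in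
/-- `R₀` depends on nothing but the sphere. The boundary vertex set of the competitor `Γ` is any
set `D` of its vertices with image `{A, B, C}`, for instance its vertices of order one if these are
mapped onto `{A, B, C}`. -/
theorem theorem4p2 :
    ∃ R₀ : ℝ, 0 < R₀ ∧ ∀ (p₀ : S2) (R : ℝ), 0 < R → R < R₀ →
      ∀ (A B C : S2), A ∈ geodesicBall p₀ R → B ∈ geodesicBall p₀ R → C ∈ geodesicBall p₀ R →
        A ≠ B → A ≠ C → B ≠ C →
      ∀ (S : S2) (Γs : ImmersedNetwork), S ∈ geodesicBall p₀ R →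
        Γs.IsSteinerTripod S A B C → Γs.ContainedIn (geodesicBall p₀ R) →
      ∀ (Γ : ImmersedNetwork) (D : Set Γ.Vertex), Γ.point '' D = {A, B, C} →
        Γ.ContainedIn (geodesicBall p₀ R) →
        Γs.length ≤ Γ.length := by
  refine ⟨π / 8, by positivity, ?_⟩
  intro p₀ R _ hR A B C _ _ _ _ _ _ S Γs hS hst hΓs Γ D hD hΓ
  obtain ⟨a, -, rfl⟩ : A ∈ Γ.point '' D := by simp [hD]
  obtain ⟨b, -, rfl⟩ : B ∈ Γ.point '' D := by simp [hD]
  obtain ⟨c, -, rfl⟩ : C ∈ Γ.point '' D := by simp [hD]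
  obtain ⟨s, dA, dB, dC, -, rfl, hAB, hAC, hBC, hall, htA, htB, htC, hA, hB, hC, harc, hsum⟩ := hst
  have hlen : Γs.length = curveLength (Γs.curve dA.1) + curveLength (Γs.curve dB.1) +
      curveLength (Γs.curve dC.1) := by
    have huniv : (Finset.univ : Finset (Fin Γs.N)) = {dA.1, dB.1, dC.1} := by
      ext i
      simpa using hall i
    rw [length, huniv, Finset.sum_insert (by simp [hAB, hAC]), Finset.sum_insert (by simp [hBC]),
      Finset.sum_singleton, add_assoc]
  obtain ⟨p, hp⟩ := exists_vertex_sphereDist_add_le_length Γ hR hΓ a b c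
  have hSP := sphereDist_lt_of_mem_geodesicBall hS (point_mem_of_containedIn hΓ p)
  obtain ⟨hA0, hA1, hAn, hAo, hAe⟩ := dart_eq_geodesic hR hΓs dA (harc _)
  obtain ⟨hB0, hB1, hBn, hBo, hBe⟩ := dart_eq_geodesic hR hΓs dB (harc _)
  obtain ⟨hC0, hC1, hCn, hCo, hCe⟩ := dart_eq_geodesic hR hΓs dC (harc _)
  rw [htA] at hAo hAe
  rw [htB] at hBo hBe
  rw [htC] at hCo hCe
  have h := add_add_le_angle_of_tangents_sum_zero (norm_coe_sphere (Γs.point s))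
    (norm_coe_sphere (Γ.point p)) (by unfold sphereDist at hSP; linarith) hAn hBn hCn hAo hBo hCo
    hsum hA0 hA1 hB0 hB1 hC0 hC1
  rw [← hAe, ← hBe, ← hCe, hA, hB, hC] at h
  rw [hlen]
  exact h.trans hp
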